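/- Let $N\ge 0$, let $f:\mathbb{R}^N\to\mathbb{R}$ be measurable, let $\xi\sim\mathcal N(0,\mathrm{Id}_N)$, assume that $\operatorname{E}[f(\xi)^2]<\infty$ (so that the mean and the variance below exist), and put $$m=\operatorname{E}[f(\xi)],\qquad g(A,x)=\tfrac12\bigl(f(x)+f(Ax)\bigr)\quad(A\in O(N),\ x\in\mathbb{R}^N).$$ On a probability space $(\Omega,\mathcal F,P)$ let $\{\xi_k\}_{k\ge1}$ be i.i.d. $\mathcal N(0,\mathrm{Id}_N)$ vectors and $\{\zeta_k\}_{k\ge1}$ i.i.d. Gaussian vectors (of any dimension $M$ and any Gaussian law), the two sequences being independent of each other, and let $\mathcal F_k=\sigma(\xi_i,\zeta_i\mid 1\le i\le k)$ for $k\ge0$. Let $A^*\in O(N)$, and let $\{A_k\}_{k\ge0}$ be $O(N)$-valued random variables such that $A_k$ is $\mathcal F_k$-measurable for every $k$ and $A_k\to A^*$ in probability as $k\to\infty$. Assume that $\operatorname{E}[|g(A_{k-1},\xi)|^4]<\infty$ for every $k\ge1$, where $\xi\sim\mathcal N(0,\mathrm{Id}_N)$ is independent of $A_{k-1}$, and that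 for every real $p$ with $1\le p\le4$ the map $A\mapsto \operatorname{E}[|g(A,\xi)|^p]\in[0,\infty]$ on $O(N)$ is continuous at $A^*$. Let $$S_n=\frac1n\sum_{k=1}^n g(A_{k-1},\xi_k),\qquad \sigma_*^2=\operatorname{Var}[g(A^*,\xi)].$$ (i) As $n\to\infty$, $\sqrt n\,(S_n-m)$ converges in law to $\mathcal N(0,\sigma_*^2)$ (the point mass at $0$ if $\sigma_*^2=0$), and $$\sigma_*^2=\tfrac12\bigl(\operatorname{Var}[f(\xi)]+\operatorname{Cov}(f(\xi),f(A^*\xi))\bigr).$$ (ii) The empirical variance $\sigma_n^2=\frac1n\sum_{k=1}^n g(A_{k-1},\xi_k)^2-S_n^2$ converges to $\sigma_*^2$ in probability as $n\to\infty$. -/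

import Mathlib

open MeasureTheory ProbabilityTheory Filter Topology
open scoped ENNReal

namespace Antithetic

/-- The orthogonal group `O(N)` of real `N × N` matrices, as a topological group. -/
abbrev OrthGroup (N : ℕ) : Type := Matrix.orthogonalGroup (Fin N) ℝ

/-- The law `𝒩(0, Id_N)` on `ℝ^N`. -/
noncomputable abbrev stdNormal (N : ℕ) : Measure (EuclideanSpace ℝ (Fin N)) :=
  stdGaussian (EuclideanSpace ℝ (Fin N))

/-- The action `x ↦ A x` of an orthogonal matrix on `ℝ^N`. -/
noncomputable def rotate {N : ℕ} (A : OrthGroup N) (x : EuclideanSpace ℝ (Fin N)) :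
    EuclideanSpace ℝ (Fin N) :=
  Matrix.toEuclideanCLM (𝕜 := ℝ) (A : Matrix (Fin N) (Fin N) ℝ) x

/-- The antithetic average `g(A, x) = (f(x) + f(A x)) / 2`. -/
noncomputable def g {N : ℕ} (f : EuclideanSpace ℝ (Fin N) → ℝ) (A : OrthGroup N)
    (x : EuclideanSpace ℝ (Fin N)) : ℝ :=
  (f x + f (rotate A x)) / 2

/-- The σ-algebra generated by the first `k` samples of the two sequences. Samples are numbered
from `0`, so `ξ k` is the `(k+1)`-st sample; `history ξ ζ 0` is the trivial σ-algebra. -/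
@[reducible] def history {Ω E E' : Type*} [MeasurableSpace E] [MeasurableSpace E']
    (ξ : ℕ → Ω → E) (ζ : ℕ → Ω → E') (k : ℕ) : MeasurableSpace Ω :=
  ⨆ i ∈ Finset.range k,
    (MeasurableSpace.comap (ξ i) inferInstance ⊔ MeasurableSpace.comap (ζ i) inferInstance)

/-- The dynamic Monte Carlo estimator `S_n = (1/n) ∑_{k=1}^n g(A_{k-1}, ξ_k)`; since samples are
numbered from `0`, the sample that the `k`-th matrix is paired with is `ξ k`. -/
noncomputable def S {Ω : Type*} {N : ℕ} (f : EuclideanSpace ℝ (Fin N) → ℝ)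
    (A : ℕ → Ω → OrthGroup N) (ξ : ℕ → Ω → EuclideanSpace ℝ (Fin N)) (n : ℕ) (ω : Ω) : ℝ :=
  (1 / (n : ℝ)) * ∑ k ∈ Finset.range n, g f (A k ω) (ξ k ω)

/-- The empirical variance `σ_n² = (1/n) ∑_{k=1}^n g(A_{k-1}, ξ_k)² - S_n²`. -/
noncomputable def empiricalVariance {Ω : Type*} {N : ℕ} (f : EuclideanSpace ℝ (Fin N) → ℝ)
    (A : ℕ → Ω → OrthGroup N) (ξ : ℕ → Ω → EuclideanSpace ℝ (Fin N)) (n : ℕ) (ω : Ω) : ℝ :=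
  (1 / (n : ℝ)) * ∑ k ∈ Finset.range n, g f (A k ω) (ξ k ω) ^ 2 - S f A ξ n ω ^ 2

/-- The asymptotic variance `σ_*² = Var[g(A, ξ)]`, `ξ ∼ 𝒩(0, Id_N)`. -/
noncomputable def asymptoticVariance {N : ℕ} (f : EuclideanSpace ℝ (Fin N) → ℝ)
    (A : OrthGroup N) : ℝ :=
  variance (g f A) (stdNormal N)

/-- Convergence in probability of random elements `X k` of a topological space to a point `x`. -/
def ConvergesInProbTo {Ω E : Type*} [MeasurableSpace Ω] [TopologicalSpace E] (P : Measure Ω)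
    (X : ℕ → Ω → E) (x : E) : Prop :=
  ∀ V ∈ 𝓝 x, Tendsto (fun k => P {ω | X k ω ∉ V}) atTop (𝓝 0)

end Antithetic

/-! Replacing the random matrix by its limit costs `g f (A k) (ξ k) - g f B (ξ k) = D k / 2`, where
`D k = f (A k ξ k) - f (B ξ k)` is `rotationError`. With `A k` frozen, the Gaussian law is rotation
invariant, so both terms of `D k` have the same mean. Since `ξ k` is independent of the past, `D k`
is centred given the past, and the `D k` are orthogonal in L² (`integral_rotationError_mul`).

Moreover `E[D k ^ 2] = E[d (A k)]` with `d C = ‖f ∘ C - f ∘ B‖₂²`. This `d` is bounded, and tends to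
`0` at `B` because rotations act continuously on L² (`tendsto_eLpNorm_comp_rotate_sub`). Convergence
in probability of `A k` therefore gives `E[D k ^ 2] → 0`. By orthogonality, the second moment of
`n^(-1/2) ∑ D k` is a Cesàro mean of these numbers and vanishes in the limit.

Hence the classical central limit theorem for the i.i.d. variables `g f B (ξ k)` passes to `S` by
Slutsky's theorem. For the empirical variance, the strong law for the same i.i.d. variables is
combined with L¹ error bounds from Cauchy–Schwarz. -/

namespace Antithetic

/-! ### Rotation invariance of the Gaussian law and strong continuity on L². -/

section Rotate

variable {N : ℕ}

lemma rotate_eq_linearIsometryEquiv (A : OrthGroup N) : ∃ e : EuclideanSpace ℝ (Fin N) ≃ₗᵢ[ℝ]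
    EuclideanSpace ℝ (Fin N), rotate A = e := by
  exact ⟨Unitary.linearIsometryEquiv ⟨Matrix.toEuclideanCLM (n := Fin N) (𝕜 := ℝ) A.1,
    Unitary.map_mem (Matrix.toEuclideanCLM (n := Fin N) (𝕜 := ℝ)) A.2⟩, rfl⟩

lemma measurePreserving_rotate (A : OrthGroup N) :
    MeasurePreserving (rotate A) (stdNormal N) (stdNormal N) := by
  obtain ⟨e, he⟩ := rotate_eq_linearIsometryEquiv A
  rw [he]
  exact ⟨e.continuous.measurable, stdGaussian_map e⟩

lemma continuous_rotate_left (x : EuclideanSpace ℝ (Fin N)) :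
    Continuous fun A : OrthGroup N => rotate A x := by
  refine (PiLp.continuous_toLp 2 _).comp ?_
  exact Continuous.matrix_mulVec continuous_subtype_val continuous_const

lemma measurable_rotate {Ω : Type*} {m : MeasurableSpace Ω} {A : Ω → OrthGroup N}
    {x : Ω → EuclideanSpace ℝ (Fin N)}
    (hA : ∀ i j, Measurable fun ω => (A ω : Matrix (Fin N) (Fin N) ℝ) i j) (hx : Measurable x) :
    Measurable fun ω => rotate (A ω) (x ω) := by
  have h : Measurable fun ω => (A ω : Matrix (Fin N) (Fin N) ℝ).mulVec (x ω).ofLp := by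
    refine measurable_pi_lambda _ fun i => ?_
    simp only [Matrix.mulVec, dotProduct]
    exact Finset.measurable_sum _ fun j _ => (hA i j).mul (by fun_prop)
  exact (PiLp.continuous_toLp 2 _).measurable.comp h

variable {f : EuclideanSpace ℝ (Fin N) → ℝ}

lemma eLpNorm_comp_rotate (hf : AEStronglyMeasurable f (stdNormal N)) (p : ℝ≥0∞)
    (A : OrthGroup N) :
    eLpNorm (fun x => f (rotate A x)) p (stdNormal N) = eLpNorm f p (stdNormal N) :=
  eLpNorm_comp_measurePreserving hf (measurePreserving_rotate A)

lemma memLp_comp_rotate {p : ℝ≥0∞} (hf : MemLp f p (stdNormal N)) (A : OrthGroup N) :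
    MemLp (fun x => f (rotate A x)) p (stdNormal N) :=
  hf.comp_measurePreserving (measurePreserving_rotate A)

/-- Rotations act continuously on `L²` of the standard normal law. -/
lemma tendsto_eLpNorm_comp_rotate_sub (hf : MemLp f 2 (stdNormal N)) (B : OrthGroup N) :
    Tendsto (fun A => eLpNorm (fun x => f (rotate A x) - f (rotate B x)) 2 (stdNormal N))
      (𝓝 B) (𝓝 0) := by
  refine ENNReal.tendsto_nhds_zero.2 fun ε hε => ?_
  have hε3 : ε / 3 ≠ 0 := (ENNReal.div_pos hε.ne' (by simp)).ne'
  -- Bounded continuous functions are dense in L². Since rotations are L² isometries, the error `ε /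
  -- 3` of approximating by `c` is the same at every matrix.
  obtain ⟨c, hc, hc2⟩ := hf.exists_boundedContinuous_eLpNorm_sub_le (by simp) hε3
  have hcont : Tendsto (fun A => eLpNorm (fun x => c (rotate A x) - c (rotate B x)) 2
      (stdNormal N)) (𝓝 B) (𝓝 0) := by
    have h : Tendsto (fun A => ∫⁻ x, ‖c (rotate A x) - c (rotate B x)‖ₑ ^ (2 : ℝ) ∂(stdNormal N))
        (𝓝 B) (𝓝 (∫⁻ _, 0 ∂(stdNormal N))) := by
      -- Dominated convergence along `𝓝 B` needs a countably generated filter.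
      have : (𝓝 B).IsCountablyGenerated := by
        rw [nhds_subtype_eq_comap]
        have : (𝓝 (B : Matrix (Fin N) (Fin N) ℝ)).IsCountablyGenerated :=
          FirstCountableTopology.nhds_generated_countable (α := Fin N → Fin N → ℝ) B.1
        infer_instance
      refine tendsto_lintegral_filter_of_dominated_convergence
        (fun _ => (‖c‖ₑ + ‖c‖ₑ) ^ (2 : ℝ)) ?_ ?_ ?_ ?_
      · refine Eventually.of_forall fun A => ?_
        have h1 := (measurePreserving_rotate A).measurable
        have h2 := (measurePreserving_rotate B).measurable
        have h3 := c.continuous.measurable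
        exact (((h3.comp h1).sub (h3.comp h2)).enorm.pow_const _)
      · refine Eventually.of_forall fun A => Eventually.of_forall fun x => ?_
        refine ENNReal.rpow_le_rpow ((enorm_sub_le).trans (add_le_add ?_ ?_)) (by norm_num) <;>
          exact enorm_le_iff_norm_le.2 (c.norm_coe_le_norm _)
      · simp only [lintegral_const, measure_univ, mul_one]
        exact (ENNReal.rpow_lt_top_of_nonneg (by norm_num) (by simp)).ne
      · refine Eventually.of_forall fun x => ?_
        have h1 : Tendsto (fun A => c (rotate A x) - c (rotate B x)) (𝓝 B) (𝓝 0) := by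
          rw [← sub_self (c (rotate B x))]
          exact ((c.continuous.comp (continuous_rotate_left x)).tendsto B).sub_const _
        have h2 := (ENNReal.continuous_rpow_const (y := (2 : ℝ))).tendsto 0 |>.comp
          (by simpa using h1.enorm : Tendsto (fun A => ‖c (rotate A x) - c (rotate B x)‖ₑ)
            (𝓝 B) (𝓝 0))
        simpa [Function.comp_def] using h2
    have h2 := ((ENNReal.continuous_rpow_const (y := (1 / 2 : ℝ))).tendsto _).comp h
    simpa [eLpNorm_eq_lintegral_rpow_enorm_toReal, Function.comp_def] using h2
  have hev := ENNReal.tendsto_nhds_zero.1 hcont (ε / 3) (pos_iff_ne_zero.2 hε3)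
  filter_upwards [hev] with A hA
  have hm (C : OrthGroup N) : MemLp (fun x => (f - c) (rotate C x)) 2 (stdNormal N) :=
    memLp_comp_rotate (hf.sub hc2) C
  have hn (C : OrthGroup N) : eLpNorm (fun x => (f - c) (rotate C x)) 2 (stdNormal N) ≤ ε / 3 :=
    (eLpNorm_comp_rotate (hf.sub hc2).1 2 C).trans_le hc
  have hcm : AEStronglyMeasurable (fun x => c (rotate A x) - c (rotate B x)) (stdNormal N) :=
    ((memLp_comp_rotate hc2 A).sub (memLp_comp_rotate hc2 B)).1
  calc eLpNorm (fun x => f (rotate A x) - f (rotate B x)) 2 (stdNormal N)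
      = eLpNorm (((fun x => (f - c) (rotate A x)) + fun x => c (rotate A x) - c (rotate B x))
          - fun x => (f - c) (rotate B x)) 2 (stdNormal N) := by
        congr 1; ext x; simp
    _ ≤ ε / 3 + ε / 3 + ε / 3 := by
        refine (eLpNorm_sub_le ((hm A).1.add hcm) (hm B).1 (by norm_num)).trans
          (add_le_add ((eLpNorm_add_le (hm A).1 hcm (by norm_num)).trans
            (add_le_add (hn A) hA)) (hn B))
    _ = ε := ENNReal.add_thirds ε

end Rotate

/-! ### Independence of the next sample from the past. -/

section Independence

lemma history_mono {Ω E E' : Type*} [MeasurableSpace E] [MeasurableSpace E'] {ξ : ℕ → Ω → E}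
    {ζ : ℕ → Ω → E'} : Monotone (history ξ ζ) := fun _ _ h =>
  biSup_mono fun _ hi => Finset.range_mono h hi

lemma measurable_history_succ_left {Ω E E' : Type*} [MeasurableSpace E] [MeasurableSpace E']
    {ξ : ℕ → Ω → E} {ζ : ℕ → Ω → E'} (k : ℕ) : Measurable[history ξ ζ (k + 1)] (ξ k) := by
  refine Measurable.mono (comap_measurable (ξ k)) ?_ le_rfl
  exact le_sup_left.trans (le_biSup (fun i => MeasurableSpace.comap (ξ i) inferInstance ⊔
    MeasurableSpace.comap (ζ i) inferInstance) (Finset.self_mem_range_succ k))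

variable {Ω : Type*} [MeasurableSpace Ω] {P : Measure Ω} [IsProbabilityMeasure P]

/-- The joint law of the three variables is a product of three measures, and permuting the factors
keeps it one. -/
lemma indepFun_prodMk_left_of_indepFun {α β γ : Type*} [MeasurableSpace α] [MeasurableSpace β]
    [MeasurableSpace γ] {U : Ω → α} {V : Ω → β} {Z : Ω → γ} (hU : Measurable U)
    (hV : Measurable V) (hZ : Measurable Z) (hUV : IndepFun U V P)
    (hUVZ : IndepFun (fun ω => (U ω, V ω)) Z P) : IndepFun (fun ω => (U ω, Z ω)) V P := by
  have := Measure.isProbabilityMeasure_map (μ := P) hU.aemeasurable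
  have := Measure.isProbabilityMeasure_map (μ := P) hV.aemeasurable
  have := Measure.isProbabilityMeasure_map (μ := P) hZ.aemeasurable
  have hUZ : IndepFun U Z P := hUVZ.comp measurable_fst measurable_id
  rw [indepFun_iff_map_prod_eq_prod_map_map (by fun_prop) (by fun_prop)] at hUV hUVZ hUZ ⊢
  rw [hUV] at hUVZ
  rw [hUZ]
  have hs : MeasurePreserving (fun z : (α × β) × γ => ((z.1.1, z.2), z.1.2))
      (((P.map U).prod (P.map V)).prod (P.map Z)) (((P.map U).prod (P.map Z)).prod (P.map V)) := by
    have h1 := measurePreserving_prodAssoc (P.map U) (P.map V) (P.map Z)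
    have h2 : MeasurePreserving (Prod.swap : β × γ → γ × β) ((P.map V).prod (P.map Z))
      ((P.map Z).prod (P.map V)) := Measure.measurePreserving_swap
    have h3 := (measurePreserving_prodAssoc (P.map U) (P.map Z) (P.map V)).symm
    exact h3.comp (((MeasurePreserving.id (P.map U)).prod h2).comp h1)
  rw [← hs.map_eq, ← hUVZ, Measure.map_map hs.measurable (by fun_prop)]
  rfl

variable {E E' : Type*} [MeasurableSpace E] [MeasurableSpace E']
  {ξ : ℕ → Ω → E} {ζ : ℕ → Ω → E'}

lemma history_le (hξ : ∀ k, Measurable (ξ k)) (hζ : ∀ k, Measurable (ζ k)) (k : ℕ) :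
    history ξ ζ k ≤ ‹MeasurableSpace Ω› :=
  iSup₂_le fun i _ => sup_le (hξ i).comap_le (hζ i).comap_le

/-- The past may be enlarged by the entire sequence `ζ`: the earlier `ξ i` together with all of `ζ`
are still independent of `ξ k`, and they generate a σ-algebra containing the history. -/
lemma indep_history (hξ : ∀ k, Measurable (ξ k)) (hζ : ∀ k, Measurable (ζ k))
    (hξ_indep : iIndepFun ξ P) (hξζ : IndepFun (fun ω k => ξ k ω) (fun ω k => ζ k ω) P) (k : ℕ) :
    Indep (history ξ ζ k) (MeasurableSpace.comap (ξ k) inferInstance) P := by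
  have h1 : IndepFun (fun ω (i : Finset.range k) => ξ i ω) (ξ k) P :=
    (hξ_indep.indepFun_finset (Finset.range k) {k} (by simp) hξ).comp (measurable_id)
      (measurable_pi_apply (⟨k, by simp⟩ : ({k} : Finset ℕ)))
  have h2 : IndepFun (fun ω => ((fun (i : Finset.range k) => ξ i ω), ξ k ω))
      (fun ω k => ζ k ω) P :=
    hξζ.comp (φ := fun x : ℕ → E => ((fun (i : Finset.range k) => x i), x k)) (by fun_prop)
      measurable_id
  have h3 := indepFun_prodMk_left_of_indepFun (by fun_prop) (hξ k) (by fun_prop) h1 h2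
  refine indep_of_indep_of_le_left h3 (iSup₂_le fun i hi => sup_le ?_ ?_)
  · rw [← measurable_iff_comap_le]
    have h : Measurable fun z : (Finset.range k → E) × (ℕ → E') => z.1 ⟨i, hi⟩ := by fun_prop
    exact h.comp (comap_measurable _)
  · rw [← measurable_iff_comap_le]
    have h : Measurable fun z : (Finset.range k → E) × (ℕ → E') => z.2 i := by fun_prop
    exact h.comp (comap_measurable _)

/-- A variable that depends on the past is paired with the next sample as with an independent
copy of it. -/
lemma identDistrib_prodMk_history (hξ : ∀ k, Measurable (ξ k)) (hζ : ∀ k, Measurable (ζ k))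
    (hξ_indep : iIndepFun ξ P) (hξζ : IndepFun (fun ω k => ξ k ω) (fun ω k => ζ k ω) P)
    {μ : Measure E} [IsProbabilityMeasure μ] {k : ℕ} (hlaw : HasLaw (ξ k) μ P)
    {β : Type*} [MeasurableSpace β] {X : Ω → β} (hX : Measurable[history ξ ζ k] X) :
    IdentDistrib (fun ω => (X ω, ξ k ω)) (fun z : Ω × E => (X z.1, z.2)) P (P.prod μ) := by
  have hX' : Measurable X := hX.mono (history_le hξ hζ k) le_rfl
  have hk := hξ k
  have hi : IndepFun X (ξ k) P :=
    indep_of_indep_of_le_left (indep_history hξ hζ hξ_indep hξζ k) hX.comap_le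
  refine ⟨by fun_prop, by fun_prop, ?_⟩
  rw [(indepFun_iff_map_prod_eq_prod_map_map (by fun_prop) (by fun_prop)).1 hi, hlaw.map_eq]
  have := Measure.map_prod_map P μ hX' measurable_id
  rw [Measure.map_id] at this
  exact this

end Independence

/-! ### Convergence in measure: moment criteria and continuous mapping. -/

section InMeasure

variable {Ω : Type*} [MeasurableSpace Ω] {P : Measure Ω}

/-- Splitting at the level `ε / 2` bounds the integral by `ε / 2 + C * P {ε / 2 ≤ h k}`. -/
lemma tendsto_lintegral_zero_of_bounded [IsProbabilityMeasure P] {h : ℕ → Ω → ℝ≥0∞}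
    (hm : ∀ k, Measurable (h k)) {C : ℝ≥0∞} (hC : C ≠ ∞) (hb : ∀ k ω, h k ω ≤ C)
    (hP : ∀ ε > 0, Tendsto (fun k => P {ω | ε ≤ h k ω}) atTop (𝓝 0)) :
    Tendsto (fun k => ∫⁻ ω, h k ω ∂P) atTop (𝓝 0) := by
  refine ENNReal.tendsto_nhds_zero.2 fun ε hε => ?_
  have hε2 : 0 < ε / 2 := ENNReal.div_pos hε.ne' (by simp)
  have h1 : Tendsto (fun k => C * P {ω | ε / 2 ≤ h k ω}) atTop (𝓝 0) := by
    simpa using ENNReal.Tendsto.const_mul (hP _ hε2) (Or.inr hC)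
  filter_upwards [ENNReal.tendsto_nhds_zero.1 h1 _ hε2] with k hk
  have hs : MeasurableSet {ω | ε / 2 ≤ h k ω} := measurableSet_le measurable_const (hm k)
  calc ∫⁻ ω, h k ω ∂P
      ≤ ∫⁻ ω, (ε / 2 + {ω | ε / 2 ≤ h k ω}.indicator (fun _ => C) ω) ∂P := by
        refine lintegral_mono fun ω => ?_
        by_cases hω : ε / 2 ≤ h k ω
        · rw [Set.indicator_of_mem (by exact hω)]
          exact (hb k ω).trans le_add_self
        · exact (not_le.1 hω).le.trans le_self_add
    _ = ε / 2 + C * P {ω | ε / 2 ≤ h k ω} := by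
        rw [lintegral_add_left measurable_const, lintegral_indicator_const hs]; simp
    _ ≤ ε / 2 + ε / 2 := by gcongr
    _ = ε := ENNReal.add_halves ε

lemma tendstoInMeasure_of_tendsto_integral_sq {Y : ℕ → Ω → ℝ}
    (hY : ∀ n, MemLp (Y n) 2 P) (h : Tendsto (fun n => ∫ ω, Y n ω ^ 2 ∂P) atTop (𝓝 0)) :
    TendstoInMeasure P Y atTop 0 := by
  refine tendstoInMeasure_of_tendsto_eLpNorm (p := 2) (by simp) (fun n => (hY n).1)
    aestronglyMeasurable_zero ?_
  have h2 : ∀ n, eLpNorm (Y n - 0) 2 P = ENNReal.ofReal √(∫ ω, Y n ω ^ 2 ∂P) := fun n => by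
    rw [sub_zero, (hY n).eLpNorm_eq_integral_rpow_norm (by simp) (by simp), Real.sqrt_eq_rpow]
    simp
  simp_rw [h2]
  simpa using ENNReal.tendsto_ofReal ((Real.continuous_sqrt.tendsto _).comp h)

/-- Orthogonal variables with vanishing second moments are negligible on the scale of the central
limit theorem. -/
lemma tendstoInMeasure_inv_sqrt_mul_sum {D : ℕ → Ω → ℝ} (hD : ∀ k, MemLp (D k) 2 P)
    (horth : ∀ j k, j < k → ∫ ω, D j ω * D k ω ∂P = 0)
    (h : Tendsto (fun k => ∫ ω, D k ω ^ 2 ∂P) atTop (𝓝 0)) :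
    TendstoInMeasure P (fun (n : ℕ) ω => (√n)⁻¹ * ∑ k ∈ Finset.range n, D k ω) atTop 0 := by
  refine tendstoInMeasure_of_tendsto_integral_sq
    (fun n => (memLp_finsetSum _ fun k _ => hD k).const_mul _) ?_
  have horth' : ∀ j k, j ≠ k → ∫ ω, D j ω * D k ω ∂P = 0 := fun j k hjk => by
    rcases lt_or_gt_of_ne hjk with hlt | hlt
    · exact horth j k hlt
    · simpa only [mul_comm] using horth k j hlt
  have h1 : ∀ n : ℕ, ∫ ω, ((√n)⁻¹ * ∑ k ∈ Finset.range n, D k ω) ^ 2 ∂P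
      = (n : ℝ)⁻¹ * ∑ k ∈ Finset.range n, ∫ ω, D k ω ^ 2 ∂P := fun n => by
    simp_rw [mul_pow, inv_pow, Real.sq_sqrt (Nat.cast_nonneg n), sq (Finset.sum _ _),
      Finset.sum_mul_sum]
    have hi : ∀ j k, Integrable (fun ω => D j ω * D k ω) P := fun j k => (hD j).integrable_mul (hD k)
    rw [integral_const_mul, integral_finsetSum _ fun j _ => integrable_finsetSum _ fun k _ => hi j k]
    congr 1
    refine Finset.sum_congr rfl fun j hj => ?_
    rw [integral_finsetSum _ fun k _ => hi j k, Finset.sum_eq_single j]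
    · simp_rw [sq]
    · exact fun k _ hk => horth' j k hk.symm
    · exact fun h' => absurd hj h'
  simp_rw [h1]
  exact h.cesaro

/-- The triangle inequality bounds the L¹ norm of the average by a Cesàro mean. No orthogonality is
required at the scale of the law of large numbers. -/
lemma tendstoInMeasure_inv_mul_sum {R : ℕ → Ω → ℝ} (hR : ∀ k, Integrable (R k) P)
    (h : Tendsto (fun k => ∫ ω, |R k ω| ∂P) atTop (𝓝 0)) :
    TendstoInMeasure P (fun (n : ℕ) ω => (n : ℝ)⁻¹ * ∑ k ∈ Finset.range n, R k ω) atTop 0 := by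
  have hi : ∀ n : ℕ, Integrable (fun ω => (n : ℝ)⁻¹ * ∑ k ∈ Finset.range n, R k ω) P :=
    fun n => (integrable_finsetSum _ fun k _ => hR k).const_mul _
  refine tendstoInMeasure_of_tendsto_eLpNorm (p := 1) (by simp) (fun n => (hi n).1)
    aestronglyMeasurable_zero ?_
  have h2 : ∀ n : ℕ, eLpNorm ((fun ω => (n : ℝ)⁻¹ * ∑ k ∈ Finset.range n, R k ω) - 0) 1 P
      = ENNReal.ofReal (∫ ω, |(n : ℝ)⁻¹ * ∑ k ∈ Finset.range n, R k ω| ∂P) := fun n => by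
    rw [sub_zero, eLpNorm_one_eq_lintegral_enorm, ← ofReal_integral_norm_eq_lintegral_enorm (hi n)]
    rfl
  simp_rw [h2]
  rw [← ENNReal.ofReal_zero]
  refine ENNReal.tendsto_ofReal (squeeze_zero (fun n => integral_nonneg fun ω => abs_nonneg _)
    (fun n => ?_) h.cesaro)
  have hsum : Integrable (fun ω => ∑ k ∈ Finset.range n, |R k ω|) P :=
    integrable_finsetSum _ fun k _ => (hR k).abs
  rw [← integral_finsetSum _ fun k _ => (hR k).abs, ← integral_const_mul]
  refine integral_mono (hi n).abs (hsum.const_mul _) fun ω => ?_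
  simp only [abs_mul, abs_inv, Nat.abs_cast]
  gcongr
  exact Finset.abs_sum_le_sum_abs _ _

/-- Convergence in measure means that every subsequence has a further subsequence converging almost
everywhere. Extracting twice makes both sequences converge, and continuity applies pointwise. -/
lemma TendstoInMeasure.continuous_comp₂ [IsFiniteMeasure P] {u v : ℕ → Ω → ℝ} {a b : Ω → ℝ}
    (hu : TendstoInMeasure P u atTop a) (hv : TendstoInMeasure P v atTop b)
    (hum : ∀ n, AEStronglyMeasurable (u n) P) (hvm : ∀ n, AEStronglyMeasurable (v n) P)
    {φ : ℝ × ℝ → ℝ} (hφ : Continuous φ) :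
    TendstoInMeasure P (fun n ω => φ (u n ω, v n ω)) atTop fun ω => φ (a ω, b ω) := by
  rw [exists_seq_tendstoInMeasure_atTop_iff
    fun n => hφ.comp_aestronglyMeasurable ((hum n).prodMk (hvm n))]
  intro ns hns
  obtain ⟨n1, hn1, h1⟩ := (hu.comp hns.tendsto_atTop).exists_seq_tendsto_ae
  obtain ⟨n2, hn2, h2⟩ := ((hv.comp hns.tendsto_atTop).comp hn1.tendsto_atTop).exists_seq_tendsto_ae
  refine ⟨n1 ∘ n2, hn1.comp hn2, ?_⟩
  filter_upwards [h1, h2] with ω hω1 hω2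
  exact (hφ.tendsto _).comp ((hω1.comp hn2.tendsto_atTop).prodMk_nhds hω2)

end InMeasure

/-! ### Coupling with the limiting rotation: the error is centred, orthogonal and small in L². -/

section Coupling

/-- The difference between `f` at the sample rotated by the random matrix and at the sample rotated
by the limit. -/
noncomputable def rotationError {Ω : Type*} {N : ℕ} (f : EuclideanSpace ℝ (Fin N) → ℝ) (A : ℕ → Ω → OrthGroup N)
    (ξ : ℕ → Ω → EuclideanSpace ℝ (Fin N)) (B : OrthGroup N) (k : ℕ) (ω : Ω) : ℝ :=
  f (rotate (A k ω) (ξ k ω)) - f (rotate B (ξ k ω))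

lemma g_sub_g {Ω : Type*} {N : ℕ} (f : EuclideanSpace ℝ (Fin N) → ℝ) (A : ℕ → Ω → OrthGroup N)
    (ξ : ℕ → Ω → EuclideanSpace ℝ (Fin N)) (B : OrthGroup N) (k : ℕ) (ω : Ω) :
    g f (A k ω) (ξ k ω) - g f B (ξ k ω) = rotationError f A ξ B k ω / 2 := by
  simp only [g, rotationError]; ring

variable {Ω : Type*} [MeasurableSpace Ω] {P : Measure Ω} {N : ℕ}
  {E' : Type*} [MeasurableSpace E'] {f : EuclideanSpace ℝ (Fin N) → ℝ}
  {ξ : ℕ → Ω → EuclideanSpace ℝ (Fin N)} {ζ : ℕ → Ω → E'} {A : ℕ → Ω → OrthGroup N}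

/-- By Fubini, it suffices that each frozen rotation preserves the Gaussian law. -/
lemma hasLaw_rotate_prod [IsProbabilityMeasure P] {B : Ω → OrthGroup N}
    (hB : ∀ i j, Measurable fun ω => (B ω : Matrix (Fin N) (Fin N) ℝ) i j) :
    HasLaw (fun z : Ω × EuclideanSpace ℝ (Fin N) => rotate (B z.1) z.2) (stdNormal N)
      (P.prod (stdNormal N)) := by
  have hm : Measurable fun z : Ω × EuclideanSpace ℝ (Fin N) => rotate (B z.1) z.2 :=
    measurable_rotate (fun i j => (hB i j).comp measurable_fst) measurable_snd
  refine ⟨hm.aemeasurable, Measure.ext fun s hs => ?_⟩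
  rw [Measure.map_apply hm hs, Measure.prod_apply (hm hs)]
  have h : ∀ ω, stdNormal N (Prod.mk ω ⁻¹' ((fun z : Ω × EuclideanSpace ℝ (Fin N) =>
      rotate (B z.1) z.2) ⁻¹' s)) = stdNormal N s := fun ω =>
    (measurePreserving_rotate (B ω)).measure_preimage hs.nullMeasurableSet
  simp [h]

lemma memLp_comp_sample {Ω : Type*} [MeasurableSpace Ω] {P : Measure Ω} {N : ℕ}
    {φ : EuclideanSpace ℝ (Fin N) → ℝ} (hφ : MemLp φ 2 (stdNormal N))
    {X : Ω → EuclideanSpace ℝ (Fin N)} (hX : HasLaw X (stdNormal N) P) :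
    MemLp (fun ω => φ (X ω)) 2 P := by
  rw [← hX.map_eq] at hφ
  exact hφ.comp_of_map hX.aemeasurable

lemma memLp_g (hf2 : MemLp f 2 (stdNormal N)) (B : OrthGroup N) :
    MemLp (g f B) 2 (stdNormal N) := by
  have h := (hf2.add (memLp_comp_rotate hf2 B)).mul_const (1 / 2)
  refine h.ae_eq (Eventually.of_forall fun x => ?_)
  simp only [g, Pi.add_apply]; ring

lemma integral_comp_rotate (hf : Measurable f) (B : OrthGroup N) :
    ∫ x, f (rotate B x) ∂(stdNormal N) = ∫ x, f x ∂(stdNormal N) :=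
  ((measurePreserving_rotate B).hasLaw.integral_comp hf.aestronglyMeasurable :)

lemma integral_g (hf : Measurable f) (hf2 : MemLp f 2 (stdNormal N)) (B : OrthGroup N) :
    ∫ x, g f B x ∂(stdNormal N) = ∫ x, f x ∂(stdNormal N) := by
  simp only [g]
  rw [integral_div, integral_add (hf2.integrable (by norm_num))
    ((memLp_comp_rotate hf2 B).integrable (by norm_num)), integral_comp_rotate hf B]
  ring

lemma variance_g (hf : Measurable f) (hf2 : MemLp f 2 (stdNormal N)) (B : OrthGroup N) :
    variance (g f B) (stdNormal N) = 1 / 2 * (variance f (stdNormal N) +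
      covariance f (fun x => f (rotate B x)) (stdNormal N)) := by
  have h1 : variance (fun x => f (rotate B x)) (stdNormal N) = variance f (stdNormal N) :=
    (measurePreserving_rotate B).variance_fun_comp hf.aemeasurable
  have h2 : g f B = fun x => (1 / 2 : ℝ) * (f + fun x => f (rotate B x)) x := by
    ext x; simp only [g, Pi.add_apply]; ring
  rw [h2, variance_const_mul, variance_add hf2 (memLp_comp_rotate hf2 B), h1]
  ring

/-- Independent standard normal samples `ξ`, an auxiliary sequence `ζ` independent of them, and
random rotations `A` that depend on the past samples only. -/
structure AdaptedSampling (P : Measure Ω) (ξ : ℕ → Ω → EuclideanSpace ℝ (Fin N)) (ζ : ℕ → Ω → E')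
    (A : ℕ → Ω → OrthGroup N) : Prop where
  measurable_sample : ∀ k, Measurable (ξ k)
  measurable_aux : ∀ k, Measurable (ζ k)
  hasLaw : ∀ k, HasLaw (ξ k) (stdNormal N) P
  iIndepFun : iIndepFun ξ P
  indepFun : IndepFun (fun ω k => ξ k ω) (fun ω k => ζ k ω) P
  adapted : ∀ k i j, Measurable[history ξ ζ k]
    fun ω => (A k ω : Matrix (Fin N) (Fin N) ℝ) i j

namespace AdaptedSampling

variable (B : OrthGroup N)

lemma measurable_entry (h : AdaptedSampling P ξ ζ A) (k : ℕ) (i j : Fin N) :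
    Measurable fun ω => (A k ω : Matrix (Fin N) (Fin N) ℝ) i j :=
  (h.adapted k i j).mono (history_le h.measurable_sample h.measurable_aux k) le_rfl

lemma measurable_rotationError (h : AdaptedSampling P ξ ζ A) (hf : Measurable f) (k : ℕ) :
    Measurable[history ξ ζ (k + 1)] (rotationError f A ξ B k) := by
  have hx : Measurable[history ξ ζ (k + 1)] (ξ k) := measurable_history_succ_left k
  exact (hf.comp (measurable_rotate (fun i j => (h.adapted k i j).mono
    (history_mono k.le_succ) le_rfl) hx)).sub
      (hf.comp ((measurePreserving_rotate B).measurable.comp hx))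

variable [IsProbabilityMeasure P]

/-- The matrix enters through its array of entries, the form in which its measurability is given.
The extra coordinate `Y` carries a quantity from the past, as the orthogonality argument requires.
-/
lemma identDistrib_rotate (h : AdaptedSampling P ξ ζ A) (k : ℕ) {Y : Ω → ℝ} (hY : Measurable[history ξ ζ k] Y) :
    IdentDistrib (fun ω => (Y ω, rotate (A k ω) (ξ k ω), ξ k ω))
      (fun z : Ω × EuclideanSpace ℝ (Fin N) => (Y z.1, rotate (A k z.1) z.2, z.2)) P
      (P.prod (stdNormal N)) := by
  have hX : Measurable[history ξ ζ k]
      fun ω => (Y ω, fun i j => (A k ω : Matrix (Fin N) (Fin N) ℝ) i j) :=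
    hY.prodMk (@measurable_pi_lambda _ _ _ (history ξ ζ k) _ _ fun i =>
      @measurable_pi_lambda _ _ _ (history ξ ζ k) _ _ fun j => h.adapted k i j)
  have hid := identDistrib_prodMk_history h.measurable_sample h.measurable_aux h.iIndepFun
    h.indepFun (h.hasLaw k) hX
  have hu : Measurable fun p : (ℝ × (Fin N → Fin N → ℝ)) × EuclideanSpace ℝ (Fin N) =>
      (p.1.1, WithLp.toLp 2 ((Matrix.of p.1.2).mulVec p.2.ofLp), p.2) := by
    have h1 : Measurable fun p : (ℝ × (Fin N → Fin N → ℝ)) × EuclideanSpace ℝ (Fin N) =>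
        (Matrix.of p.1.2).mulVec p.2.ofLp := by
      refine measurable_pi_lambda _ fun i => ?_
      simp only [Matrix.mulVec, dotProduct, Matrix.of_apply]
      fun_prop
    exact (measurable_fst.comp measurable_fst).prodMk
      (((PiLp.continuous_toLp 2 _).measurable.comp h1).prodMk measurable_snd)
  exact hid.comp hu

lemma identDistrib_rotationError (h : AdaptedSampling P ξ ζ A) (hf : Measurable f) (k : ℕ) {Y : Ω → ℝ}
    (hY : Measurable[history ξ ζ k] Y) :
    IdentDistrib (fun ω => (Y ω, rotationError f A ξ B k ω))
      (fun z : Ω × EuclideanSpace ℝ (Fin N) =>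
        (Y z.1, f (rotate (A k z.1) z.2) - f (rotate B z.2))) P (P.prod (stdNormal N)) := by
  have hu : Measurable fun p : ℝ × EuclideanSpace ℝ (Fin N) × EuclideanSpace ℝ (Fin N) =>
      (p.1, f p.2.1 - f (rotate B p.2.2)) :=
    measurable_fst.prodMk ((hf.comp (measurable_fst.comp measurable_snd)).sub
      (hf.comp ((measurePreserving_rotate B).measurable.comp
        (measurable_snd.comp measurable_snd))))
  exact (h.identDistrib_rotate k hY).comp hu

lemma hasLaw_rotate (h : AdaptedSampling P ξ ζ A) (k : ℕ) : HasLaw (fun ω => rotate (A k ω) (ξ k ω)) (stdNormal N) P :=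
  ((h.identDistrib_rotate k measurable_const (Y := fun _ => 0)).comp
    (measurable_fst.comp measurable_snd)).symm.hasLaw (hasLaw_rotate_prod (h.measurable_entry k))

lemma memLp_rotationError (h : AdaptedSampling P ξ ζ A) (hf2 : MemLp f 2 (stdNormal N)) (k : ℕ) :
    MemLp (rotationError f A ξ B k) 2 P :=
  (memLp_comp_sample hf2 (h.hasLaw_rotate k)).sub
    (memLp_comp_sample (memLp_comp_rotate hf2 B) (h.hasLaw k))

lemma integral_rotationError_mul (h : AdaptedSampling P ξ ζ A) (hf : Measurable f) (hf2 : MemLp f 2 (stdNormal N)) {j k : ℕ}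
    (hjk : j < k) :
    ∫ ω, rotationError f A ξ B j ω * rotationError f A ξ B k ω ∂P = 0 := by
  -- The error at time `j` involves `ξ j`, so it is known at time `j + 1`; `j < k` is exactly `j + 1
  -- ≤ k`.
  have hY : Measurable[history ξ ζ k] (rotationError f A ξ B j) :=
    (h.measurable_rotationError B hf j).mono (history_mono hjk) le_rfl
  have hid := (h.identDistrib_rotationError B hf k hY).comp
    (measurable_fst.mul measurable_snd : Measurable fun p : ℝ × ℝ => p.1 * p.2)
  have hint := hid.integrable_snd
    ((h.memLp_rotationError B hf2 j).integrable_mul (h.memLp_rotationError B hf2 k))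
  refine hid.integral_eq.trans ((integral_prod _ hint).trans ?_)
  -- The inner Fubini integral vanishes because all rotations of `f` have the same mean.
  have h0 : ∀ ω, ∫ x, f (rotate (A k ω) x) - f (rotate B x) ∂(stdNormal N) = 0 := fun ω => by
    rw [integral_sub ((memLp_comp_rotate hf2 _).integrable (by norm_num))
      ((memLp_comp_rotate hf2 _).integrable (by norm_num)), integral_comp_rotate hf,
      integral_comp_rotate hf, sub_self]
  simp [integral_const_mul, h0]

lemma tendsto_integral_rotationError_sq (h : AdaptedSampling P ξ ζ A) (hf : Measurable f) (hf2 : MemLp f 2 (stdNormal N))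
    (hAB : ConvergesInProbTo P A B) :
    Tendsto (fun k => ∫ ω, rotationError f A ξ B k ω ^ 2 ∂P) atTop (𝓝 0) := by
  set d : OrthGroup N → ℝ≥0∞ := fun C =>
    ∫⁻ x, ‖f (rotate C x) - f (rotate B x)‖ₑ ^ (2 : ℝ) ∂(stdNormal N) with hd
  have hdn : ∀ C, d C = eLpNorm (fun x => f (rotate C x) - f (rotate B x)) 2 (stdNormal N) ^ (2 : ℝ) :=
    fun C => by
      rw [eLpNorm_eq_lintegral_rpow_enorm_toReal (by simp) (by simp), ← ENNReal.rpow_mul]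
      simp [hd]
  have hlim : Tendsto d (𝓝 B) (𝓝 0) := by
    have h2 := ((ENNReal.continuous_rpow_const (y := (2 : ℝ))).tendsto 0).comp
      (tendsto_eLpNorm_comp_rotate_sub hf2 B)
    rw [ENNReal.zero_rpow_of_pos (by norm_num)] at h2
    exact h2.congr fun C => (hdn C).symm
  have hbound : ∀ C, d C ≤ (eLpNorm f 2 (stdNormal N) + eLpNorm f 2 (stdNormal N)) ^ (2 : ℝ) :=
    fun C => by
      rw [hdn]
      refine ENNReal.rpow_le_rpow ((eLpNorm_sub_le (memLp_comp_rotate hf2 C).1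
        (memLp_comp_rotate hf2 B).1 (by norm_num)).trans_eq ?_) (by norm_num)
      rw [eLpNorm_comp_rotate hf2.1, eLpNorm_comp_rotate hf2.1]
  have hmeas : ∀ k, Measurable fun z : Ω × EuclideanSpace ℝ (Fin N) =>
      ‖f (rotate (A k z.1) z.2) - f (rotate B z.2)‖ₑ ^ (2 : ℝ) := fun k =>
    (((hf.comp (measurable_rotate (fun i j => (h.measurable_entry k i j).comp measurable_fst)
      measurable_snd)).sub (hf.comp ((measurePreserving_rotate B).measurable.comp
        measurable_snd))).enorm.pow_const _)
  have hsq : ∀ k, ∫ ω, rotationError f A ξ B k ω ^ 2 ∂P = (∫⁻ ω, d (A k ω) ∂P).toReal := fun k => by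
    have hid := (h.identDistrib_rotationError B hf k (measurable_const (a := (0 : ℝ)))).comp
      (measurable_snd.enorm.pow_const (2 : ℝ) : Measurable fun p : ℝ × ℝ => ‖p.2‖ₑ ^ (2 : ℝ))
    have h1 : ∫⁻ ω, ‖rotationError f A ξ B k ω‖ₑ ^ (2 : ℝ) ∂P = ∫⁻ ω, d (A k ω) ∂P :=
      hid.lintegral_eq.trans (lintegral_prod _ (hmeas k).aemeasurable)
    rw [← h1, integral_eq_lintegral_of_nonneg_ae (Eventually.of_forall fun ω => sq_nonneg _)
      ((h.memLp_rotationError B hf2 k).1.pow 2)]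
    congr 1
    refine lintegral_congr fun ω => ?_
    rw [← sq_abs, ENNReal.ofReal_pow (abs_nonneg _), ← Real.enorm_eq_ofReal_abs]
    simp
  simp_rw [hsq]
  have hmain : Tendsto (fun k => ∫⁻ ω, d (A k ω) ∂P) atTop (𝓝 0) := by
    refine tendsto_lintegral_zero_of_bounded (fun k => (hmeas k).lintegral_prod_right')
      (ENNReal.rpow_ne_top_of_nonneg (by norm_num) (ENNReal.add_ne_top.2 ⟨hf2.2.ne, hf2.2.ne⟩))
      (fun k ω => hbound _) fun ε hε => ?_
    refine tendsto_of_tendsto_of_tendsto_of_le_of_le tendsto_const_nhds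
      (hAB _ (hlim.eventually (gt_mem_nhds hε))) (fun _ => zero_le) fun k => ?_
    -- The event `ε ≤ d (A k)` forces `A k` out of the neighbourhood of `B` on which `d < ε`.
    exact measure_mono fun ω (hω : ε ≤ d (A k ω)) => not_lt.2 hω
  exact (ENNReal.tendsto_toReal ENNReal.zero_ne_top).comp hmain

end AdaptedSampling

end Coupling

/-! ### The central limit theorem and consistency of the empirical variance. -/

namespace AdaptedSampling

variable {Ω : Type*} [MeasurableSpace Ω] {P : Measure Ω} [IsProbabilityMeasure P] {N : ℕ}
  {E' : Type*} [MeasurableSpace E'] {f : EuclideanSpace ℝ (Fin N) → ℝ}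
  {ξ : ℕ → Ω → EuclideanSpace ℝ (Fin N)} {ζ : ℕ → Ω → E'} {A : ℕ → Ω → OrthGroup N}
  {B : OrthGroup N}

lemma measurable_g (hf : Measurable f) (B : OrthGroup N) : Measurable (g f B) :=
  (hf.add (hf.comp (measurePreserving_rotate B).measurable)).div_const 2

lemma memLp_g_sample (h : AdaptedSampling P ξ ζ A) (hf2 : MemLp f 2 (stdNormal N)) (k : ℕ) :
    MemLp (fun ω => g f (A k ω) (ξ k ω)) 2 P := by
  refine (((memLp_comp_sample hf2 (h.hasLaw k)).add
    (memLp_comp_sample hf2 (h.hasLaw_rotate k))).mul_const (1 / 2)).ae_eq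
      (Eventually.of_forall fun ω => ?_)
  simp only [g, Pi.add_apply]; ring

theorem tendstoInDistribution_S (h : AdaptedSampling P ξ ζ A) (hf : Measurable f)
    (hf2 : MemLp f 2 (stdNormal N)) (hAB : ConvergesInProbTo P A B) :
    TendstoInDistribution
      (fun (n : ℕ) ω => √(n : ℝ) * (S f A ξ n ω - ∫ x, f x ∂(stdNormal N)))
      atTop (id : ℝ → ℝ) (fun _ => P) (gaussianReal 0 (asymptoticVariance f B).toNNReal) := by
  have hid : ∀ i, IdentDistrib (fun ω => g f B (ξ i ω)) (g f B) P (stdNormal N) := fun i =>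
    ((h.hasLaw i).identDistrib HasLaw.id).comp (measurable_g hf B)
  have hclt := tendstoInDistribution_inv_sqrt_mul_sum_sub (P := P)
    (P' := gaussianReal 0 (asymptoticVariance f B).toNNReal) (Y := id)
    (X := fun k ω => g f B (ξ k ω)) (by rw [(hid 0).variance_eq]; exact HasLaw.id)
    ((hid 0).memLp_iff.2 (memLp_g hf2 B))
    (h.iIndepFun.comp (fun _ => g f B) fun _ => measurable_g hf B)
    (fun i => (hid i).trans (hid 0).symm)
  rw [(hid 0).integral_eq, integral_g hf hf2] at hclt
  have heq : ∀ (n : ℕ) ω, √(n : ℝ) * (S f A ξ n ω - ∫ x, f x ∂(stdNormal N)) =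
      (√n)⁻¹ * (∑ k ∈ Finset.range n, g f (A k ω) (ξ k ω) - n * ∫ x, f x ∂(stdNormal N)) := by
    intro n ω
    -- At `n = 0` both sides vanish, since `√0 = 0` and `0⁻¹ = 0`.
    rcases Nat.eq_zero_or_pos n with rfl | hn
    · simp
    · have hn' : (0 : ℝ) < n := Nat.cast_pos.2 hn
      have hs : √(n : ℝ) ≠ 0 := (Real.sqrt_pos.2 hn').ne'
      have hss := Real.mul_self_sqrt hn'.le
      rw [S, eq_inv_mul_iff_mul_eq₀ hs, ← mul_assoc, hss]
      field_simp
  refine tendstoInDistribution_of_tendstoInMeasure_sub _ _ hclt ?_ fun n => ?_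
  -- Slutsky: the difference from the i.i.d. normalized sum is `n^(-1/2) ∑ D k / 2`, whose terms are
  -- orthogonal with vanishing second moments.
  · refine (tendstoInMeasure_inv_sqrt_mul_sum
      (fun k => (h.memLp_rotationError B hf2 k).mul_const (1 / 2)) (fun j k hjk => ?_) ?_).congr_left
      fun n => Eventually.of_forall fun ω => ?_
    · have := h.integral_rotationError_mul B hf hf2 hjk
      simp_rw [mul_mul_mul_comm]
      rw [integral_mul_const, this, zero_mul]
    · have := (h.tendsto_integral_rotationError_sq B hf hf2 hAB).mul_const ((1 / 2 : ℝ) ^ 2)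
      simp_rw [mul_pow, integral_mul_const]
      simpa using this
    · simp only [Pi.sub_apply, heq]
      rw [← mul_sub, sub_sub_sub_cancel_right, ← Finset.sum_sub_distrib]
      simp_rw [g_sub_g, mul_one_div]
  · refine AEMeasurable.const_mul (AEMeasurable.sub_const (AEMeasurable.const_mul
      (Finset.aemeasurable_fun_sum _ fun k _ => ?_) _) _) _
    exact (h.memLp_g_sample hf2 k).1.aemeasurable

/-- Cauchy–Schwarz. The factor `Y` is the constant `1 / 2` for the sample mean, and the midpoint of
the two values of `g` for the sample second moment. -/
lemma tendsto_integral_abs_rotationError_mul (h : AdaptedSampling P ξ ζ A) (hf : Measurable f)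
    (hf2 : MemLp f 2 (stdNormal N)) (hAB : ConvergesInProbTo P A B) {Y : ℕ → Ω → ℝ}
    (hY : ∀ k, MemLp (Y k) 2 P) {C : ℝ} (hC : ∀ k, ∫ ω, Y k ω ^ 2 ∂P ≤ C) :
    Tendsto (fun k => ∫ ω, |rotationError f A ξ B k ω * Y k ω| ∂P) atTop (𝓝 0) := by
  have hlim := ((Real.continuous_sqrt.tendsto 0).comp
    (h.tendsto_integral_rotationError_sq B hf hf2 hAB)).mul_const √C
  rw [Real.sqrt_zero, zero_mul] at hlim
  refine squeeze_zero (fun k => integral_nonneg fun _ => abs_nonneg _) (fun k => ?_) hlim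
  have hcs := integral_mul_norm_le_Lp_mul_Lq (Real.HolderConjugate.two_two)
    (by simpa using h.memLp_rotationError B hf2 k : MemLp _ (ENNReal.ofReal 2) P)
    (by simpa using hY k : MemLp _ (ENNReal.ofReal 2) P)
  simp only [Real.norm_eq_abs, Real.rpow_two, sq_abs, ← Real.sqrt_eq_rpow] at hcs
  simp_rw [abs_mul]
  exact hcs.trans (mul_le_mul_of_nonneg_left (Real.sqrt_le_sqrt (hC k)) (Real.sqrt_nonneg _))

/-- Averages along the random rotations have the limit of the averages along the fixed one. -/
lemma tendstoInMeasure_average {φ : EuclideanSpace ℝ (Fin N) → ℝ} {G : ℕ → Ω → ℝ}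
    (h : AdaptedSampling P ξ ζ A) (hφm : Measurable φ) (hφ : Integrable φ (stdNormal N))
    (hG : ∀ k, Integrable (G k) P)
    (hlim : Tendsto (fun k => ∫ ω, |G k ω - φ (ξ k ω)| ∂P) atTop (𝓝 0)) :
    TendstoInMeasure P (fun (n : ℕ) ω => (n : ℝ)⁻¹ * ∑ k ∈ Finset.range n, G k ω) atTop
      fun _ => ∫ x, φ x ∂(stdNormal N) := by
  have hid : ∀ i, IdentDistrib (fun ω => φ (ξ i ω)) φ P (stdNormal N) := fun i =>
    ((h.hasLaw i).identDistrib HasLaw.id).comp hφm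
  have hi : ∀ k, Integrable (fun ω => φ (ξ k ω)) P := fun k => (hid k).integrable_iff.2 hφ
  have hslln := strong_law_ae (μ := P) (fun k ω => φ (ξ k ω)) (hi 0)
    (fun i j hij => (h.iIndepFun.indepFun hij).comp hφm hφm)
    (fun i => (hid i).trans (hid 0).symm)
  rw [(hid 0).integral_eq] at hslln
  have hmean : ∀ n : ℕ, AEStronglyMeasurable
      (fun ω => (n : ℝ)⁻¹ • ∑ k ∈ Finset.range n, φ (ξ k ω)) P := fun n =>
    ((integrable_finsetSum _ fun k _ => hi k).const_mul _).1
  have herr := tendstoInMeasure_inv_mul_sum (fun k => (hG k).sub (hi k)) hlim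
  refine ((TendstoInMeasure.continuous_comp₂ (tendstoInMeasure_of_tendsto_ae hmean hslln) herr hmean
    (fun n => ((integrable_finsetSum _ fun k _ => (hG k).sub (hi k)).const_mul _).1)
    continuous_add).congr_left fun n => Eventually.of_forall fun ω => ?_).congr_right
      (Eventually.of_forall fun ω => ?_)
  · simp only [Pi.sub_apply, smul_eq_mul, ← mul_add, ← Finset.sum_add_distrib, add_sub_cancel]
  · simp

theorem tendstoInMeasure_empiricalVariance (h : AdaptedSampling P ξ ζ A) (hf : Measurable f)
    (hf2 : MemLp f 2 (stdNormal N)) (hAB : ConvergesInProbTo P A B) :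
    TendstoInMeasure P (empiricalVariance f A ξ) atTop fun _ => asymptoticVariance f B := by
  have hG := h.memLp_g_sample hf2
  have hg := memLp_g hf2 B
  have hgξ : ∀ k, MemLp (fun ω => g f B (ξ k ω)) 2 P := fun k => memLp_comp_sample hg (h.hasLaw k)
  have hmean : TendstoInMeasure P (fun n ω => S f A ξ n ω) atTop
      fun _ => ∫ x, g f B x ∂(stdNormal N) := by
    simp only [S, one_div]
    refine h.tendstoInMeasure_average (measurable_g hf B) (hg.integrable (by norm_num))
      (fun k => (hG k).integrable (by norm_num)) ?_
    have := h.tendsto_integral_abs_rotationError_mul hf hf2 hAB (Y := fun _ _ => 1 / 2)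
      (C := (1 / 2) ^ 2) (fun k => memLp_const _) (by simp)
    refine this.congr fun k => ?_
    simp_rw [g_sub_g, mul_one_div]
  have hsq : TendstoInMeasure P
      (fun (n : ℕ) ω => (n : ℝ)⁻¹ * ∑ k ∈ Finset.range n, g f (A k ω) (ξ k ω) ^ 2) atTop
      fun _ => ∫ x, g f B x ^ 2 ∂(stdNormal N) := by
    refine h.tendstoInMeasure_average (φ := fun x => g f B x ^ 2)
      ((measurable_g hf B).pow_const 2) hg.integrable_sq (fun k => (hG k).integrable_sq) ?_
    -- With `a`, `b` the values of `g` at `A k` and `B`, `a² - b² = (a - b)(a + b) = D k * ((a + b)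
    -- / 2)`.
    have hY : ∀ k, MemLp (fun ω => (g f (A k ω) (ξ k ω) + g f B (ξ k ω)) / 2) 2 P := fun k => by
      simp_rw [div_eq_mul_inv]
      exact ((hG k).add (hgξ k)).mul_const _
    -- The midpoint is the convex combination of `f` at `ξ k`, `A k ξ k` and `B ξ k` with weights
    -- `1/2, 1/4, 1/4`. Each point is standard normal, so convexity of the square gives a bound
    -- uniform in `k`.
    have hbound : ∀ k, ∫ ω, ((g f (A k ω) (ξ k ω) + g f B (ξ k ω)) / 2) ^ 2 ∂P
        ≤ ∫ x, f x ^ 2 ∂(stdNormal N) := fun k => by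
      have hI : ∀ {X : Ω → EuclideanSpace ℝ (Fin N)}, HasLaw X (stdNormal N) P →
          Integrable (fun ω => f (X ω) ^ 2) P ∧
            ∫ ω, f (X ω) ^ 2 ∂P = ∫ x, f x ^ 2 ∂(stdNormal N) := fun {X} hX =>
        ⟨(memLp_comp_sample hf2 hX).integrable_sq,
          hX.integral_comp (f := fun x => f x ^ 2) (hf.pow_const 2).aestronglyMeasurable⟩
      obtain ⟨i1, e1⟩ := hI (h.hasLaw k)
      obtain ⟨i2, e2⟩ := hI (h.hasLaw_rotate k)
      obtain ⟨i3, e3⟩ := hI ((measurePreserving_rotate B).fun_comp_hasLaw (h.hasLaw k))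
      have hb : ∫ ω, (f (ξ k ω) ^ 2 / 2 + (f (rotate (A k ω) (ξ k ω)) ^ 2 / 4 +
          f (rotate B (ξ k ω)) ^ 2 / 4)) ∂P = ∫ x, f x ^ 2 ∂(stdNormal N) := by
        have i23 : Integrable (fun ω => f (rotate (A k ω) (ξ k ω)) ^ 2 / 4 +
            f (rotate B (ξ k ω)) ^ 2 / 4) P := (i2.div_const 4).add (i3.div_const 4)
        rw [integral_add (i1.div_const 2) i23, integral_add (i2.div_const 4) (i3.div_const 4), integral_div, integral_div, integral_div,
          e1, e2, e3]
        ring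
      rw [← hb]
      refine integral_mono (hY k).integrable_sq
        ((i1.div_const 2).add ((i2.div_const 4).add (i3.div_const 4))) fun ω => ?_
      simp only [g]
      -- The gap in Jensen's inequality is the sum of the squared pairwise differences weighted by
      -- products of the weights.
      nlinarith [sq_nonneg (f (ξ k ω) - f (rotate (A k ω) (ξ k ω))),
        sq_nonneg (f (ξ k ω) - f (rotate B (ξ k ω))),
        sq_nonneg (f (rotate (A k ω) (ξ k ω)) - f (rotate B (ξ k ω)))]
    have := h.tendsto_integral_abs_rotationError_mul hf hf2 hAB hY hbound
    refine this.congr fun k => integral_congr_ae (Eventually.of_forall fun ω => ?_)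
    have hd := g_sub_g f A ξ B k ω
    have hd' : rotationError f A ξ B k ω = 2 * (g f (A k ω) (ξ k ω) - g f B (ξ k ω)) := by
      linarith
    simp only [hd']
    congr 1; ring
  have hv : asymptoticVariance f B =
      ∫ x, g f B x ^ 2 ∂(stdNormal N) - (∫ x, g f B x ∂(stdNormal N)) ^ 2 := by
    rw [asymptoticVariance, variance_eq_sub hg]; rfl
  rw [hv]
  have hmain := TendstoInMeasure.continuous_comp₂ hsq hmean
    (fun n => ((integrable_finsetSum _ fun k _ => (hG k).integrable_sq).const_mul _).1)
    (fun n => ((integrable_finsetSum _ fun k _ => (hG k).integrable (by norm_num)).const_mul _).1)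
    (φ := fun p => p.1 - p.2 ^ 2) (by fun_prop)
  refine hmain.congr_left fun n => Eventually.of_forall fun ω => ?_
  simp [empiricalVariance]

end AdaptedSampling

end Antithetic

theorem mainTheorem3 {Ω : Type*} [MeasurableSpace Ω] (P : Measure Ω) [IsProbabilityMeasure P]
    (N M : ℕ)
    (f : EuclideanSpace ℝ (Fin N) → ℝ) (hf : Measurable f)
    -- `f(ξ)` has a mean and a variance
    (hf2 : MemLp f 2 (Antithetic.stdNormal N))
    -- two mutually independent sequences of i.i.d. Gaussian vectors, the first one standard
    (ξ : ℕ → Ω → EuclideanSpace ℝ (Fin N)) (ζ : ℕ → Ω → EuclideanSpace ℝ (Fin M))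
    (hξ_meas : ∀ k, Measurable (ξ k)) (hζ_meas : ∀ k, Measurable (ζ k))
    (hξ_law : ∀ k, HasLaw (ξ k) (Antithetic.stdNormal N) P)
    (ν : Measure (EuclideanSpace ℝ (Fin M))) [IsGaussian ν]
    (hζ_law : ∀ k, HasLaw (ζ k) ν P)
    (hξ_indep : iIndepFun ξ P) (hζ_indep : iIndepFun ζ P)
    (hξζ_indep : IndepFun (fun ω k => ξ k ω) (fun ω k => ζ k ω) P)
    -- adapted random orthogonal matrices (measurability is that of the entries) that converge
    -- in probability to the deterministic matrix `Astar`
    (Astar : Antithetic.OrthGroup N) (A : ℕ → Ω → Antithetic.OrthGroup N)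
    (hA_adapted : ∀ k i j, Measurable[Antithetic.history ξ ζ k]
      (fun ω => (A k ω : Matrix (Fin N) (Fin N) ℝ) i j))
    (hA_tendsto : Antithetic.ConvergesInProbTo P A Astar)
    -- finite fourth moments of `g(A_k, ξ)` with `ξ` a standard Gaussian vector independent of `A_k`
    (h_moment : ∀ k, ∫⁻ z, ‖Antithetic.g f (A k z.1) z.2‖ₑ ^ 4
      ∂(P.prod (Antithetic.stdNormal N)) < ∞)
    -- continuity at `Astar` of `B ↦ E|g(B, ξ)|^p`
    (h_cont : ∀ p : ℝ, 1 ≤ p → p ≤ 4 →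
      ContinuousAt (fun B : Antithetic.OrthGroup N =>
        ∫⁻ x, ‖Antithetic.g f B x‖ₑ ^ p ∂(Antithetic.stdNormal N)) Astar) :
    TendstoInDistribution
        (fun (n : ℕ) ω => √(n : ℝ) * (Antithetic.S f A ξ n ω - ∫ x, f x ∂(Antithetic.stdNormal N)))
        atTop (id : ℝ → ℝ) (fun _ => P)
        (gaussianReal 0 (Antithetic.asymptoticVariance f Astar).toNNReal) ∧
      Antithetic.asymptoticVariance f Astar =
        1 / 2 * (variance f (Antithetic.stdNormal N) +
          covariance f (fun x => f (Antithetic.rotate Astar x)) (Antithetic.stdNormal N)) ∧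
      TendstoInMeasure P (Antithetic.empiricalVariance f A ξ) atTop
        (fun _ => Antithetic.asymptoticVariance f Astar) := by
  have h : Antithetic.AdaptedSampling P ξ ζ A :=
    ⟨hξ_meas, hζ_meas, hξ_law, hξ_indep, hξζ_indep, hA_adapted⟩
  exact ⟨h.tendstoInDistribution_S hf hf2 hA_tendsto, Antithetic.variance_g hf hf2 Astar,
    h.tendstoInMeasure_empiricalVariance hf hf2 hA_tendsto⟩
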